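/- **Proposition 2.5.** Let $k$ be a field of characteristic zero, $q$ an indeterminate, and let $F_q[G]$ be a Hopf algebra over $k(q)$. A $k[q,q^{-1}]$-integer form of $F_q[G]$ is a Hopf subalgebra $\overline{F}$ of $F_q[G]$ over $k[q,q^{-1}]$ (that is, a unital $k[q,q^{-1}]$-subalgebra with $\Delta(\overline{F})\subseteq \overline{F}\otimes_{k[q,q^{-1}]}\overline{F}$, $\epsilon(\overline{F})\subseteq k[q,q^{-1}]$ and $S(\overline{F})\subseteq\overline{F}$) such that $k(q)\otimes_{k[q,q^{-1}]}\overline{F}=F_q[G]$ via the natural map. Let $\widehat{F}_q[G]\subseteq F_q[G]$ be such that $(F_q[G],\widehat{F}_q[G])$ is a quantized function algebra (QFA); that is, $\widehat{F}_q[G]$ is a $k[q,q^{-1}]$-integer form of $F_q[G]$, and its specialization $\widehat{F}_q[G]/(q-1)\widehat{F}_q[G]=k\otimes_{k[q,q^{-1}]}\widehat{F}_q[G]$ at $q=1$ is isomorphic, as a Hopf algebra over $k$, to the algebra of regular functions of an (affine) algebraic group $G$ over $k$. Let $I$ be the kernel of the composite $\widehat{F}_q[G]\xrightarrow{\ \epsilon\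 }k[q,q^{-1}]\xrightarrow{\,q\mapsto 1\,}k$, where $\epsilon$ is the counit, and set $$\widetilde{F}_q[G]:=\sum_{n\ge 0}(q-1)^{-n}I^n\ \subseteq\ F_q[G].$$ Then $\widetilde{F}_q[G]$ is a $k[q,q^{-1}]$-integer form of $F_q[G]$. -/

import Mathlib

open scoped TensorProduct LaurentPolynomial

universe u v w

noncomputable section

namespace QuantumDuality

section HopfSubalgebras

variable {R : Type u} (K : Type v) {H : Type w} [CommRing R] [Field K] [Algebra R K]
  [Ring H] [HopfAlgebra K H] [Algebra R H] [IsScalarTower R K H]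

/-- For an `R`-subalgebra `A` of a `K`-algebra `H`, the natural map
`A ⊗[R] A → H ⊗[K] H`, `a ⊗ b ↦ a ⊗ b`. -/
def tensorInclusion (A : Subalgebra R H) : A ⊗[R] A →ₐ[R] H ⊗[K] H :=
  (Algebra.TensorProduct.mapOfCompatibleSMul K R R H H).comp
    (Algebra.TensorProduct.map A.val A.val)

/-- `A` is a Hopf subalgebra over `R` of the Hopf algebra `H` over `K = Frac R`: it is a unital
`R`-subalgebra, `Δ(A) ⊆ A ⊗[R] A` (meaning the image of `A ⊗[R] A` in `H ⊗[K] H`),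
`ε(A) ⊆ R` and `S(A) ⊆ A`. For `R` a Dedekind domain, e.g. `k[q, q⁻¹]`, the map
`A ⊗[R] A → H ⊗[K] H` is injective and such an `A` is itself a Hopf algebra over `R`: see
`IsHopfSubalgebra.hopfAlgebra` below. -/
structure IsHopfSubalgebra (A : Submodule R H) : Prop where
  one_mem : (1 : H) ∈ A
  mul_mem : ∀ x y : H, x ∈ A → y ∈ A → x * y ∈ A
  comul_mem : ∀ x ∈ A, Coalgebra.comul (R := K) x ∈
    (tensorInclusion K (A.toSubalgebra one_mem mul_mem)).range
  counit_mem : ∀ x ∈ A, Coalgebra.counit (R := K) x ∈ (algebraMap R K).range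
  antipode_mem : ∀ x ∈ A, HopfAlgebra.antipode K x ∈ A

/-- An integer form of `H` over `R` (where `K = Frac R`): a Hopf subalgebra `A` over `R` such that
`K ⊗[R] A = H` via the natural map. -/
structure IsIntegerForm (A : Submodule R H) : Prop extends IsHopfSubalgebra K A where
  isBaseChange : IsBaseChange K A.subtype

namespace IsHopfSubalgebra

variable {K} {A : Submodule R H} (h : IsHopfSubalgebra K A)


/-- The underlying `R`-subalgebra of a Hopf subalgebra. -/
abbrev toSubalgebra : Subalgebra R H := A.toSubalgebra h.one_mem h.mul_mem

variable [IsDedekindDomain R] [IsFractionRing R K]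

set_option linter.unusedSectionVars false

lemma compatibleSMul (M N : Type*) [AddCommMonoid M] [AddCommMonoid N] [Module R M] [Module R N]
    [Module K M] [Module K N] [IsScalarTower R K M] [IsScalarTower R K N] :
    TensorProduct.CompatibleSMul R K M N :=
  IsLocalization.tensorProduct_compatibleSMul (nonZeroDivisors R) K M N

lemma flat (M : Type*) [AddCommGroup M] [Module R M] [Module K M] [IsScalarTower R K M] :
    Module.Flat R M := by
  have : Module.IsTorsionFree R M := .trans_faithfulSMul R K M
  infer_instance

lemma flat_subalgebra [Module.Flat R H] (A : Subalgebra R H) : Module.Flat R A := by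
  infer_instance

variable (K) in
lemma tensorInclusion_injective (A : Subalgebra R H) :
    Function.Injective (tensorInclusion K A) := by
  have := compatibleSMul (R := R) (K := K) H H
  have : Module.Flat R H := flat (K := K) H
  have : Module.Flat R A := flat_subalgebra A
  have h1 : Function.Injective (TensorProduct.map A.val.toLinearMap A.val.toLinearMap) :=
    TensorProduct.map_injective_of_flat_flat _ _ Subtype.val_injective Subtype.val_injective
  have h2 := (TensorProduct.equivOfCompatibleSMul R K R H H).symm.injective
  exact (Algebra.TensorProduct.equivOfCompatibleSMul R K R H H).symm.injective.comp h1

/-- The comultiplication of a Hopf subalgebra. -/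
def comulAlgHom : h.toSubalgebra →ₐ[R] h.toSubalgebra ⊗[R] h.toSubalgebra :=
  (AlgEquiv.ofInjective _ (tensorInclusion_injective K h.toSubalgebra)).symm.toAlgHom.comp
    ((((Bialgebra.comulAlgHom K H).restrictScalars R).comp h.toSubalgebra.val).codRestrict
      (tensorInclusion K h.toSubalgebra).range fun x => h.comul_mem x x.2)

/-- The counit of a Hopf subalgebra. -/
def counitAlgHom : h.toSubalgebra →ₐ[R] R :=
  (AlgEquiv.ofInjective (Algebra.ofId R K) (IsFractionRing.injective R K)).symm.toAlgHom.comp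
    ((((Bialgebra.counitAlgHom K H).restrictScalars R).comp h.toSubalgebra.val).codRestrict
      (Algebra.ofId R K).range fun x => h.counit_mem x x.2)

/-- The antipode of a Hopf subalgebra. -/
def antipodeLinearMap : h.toSubalgebra →ₗ[R] h.toSubalgebra :=
  LinearMap.codRestrict (Subalgebra.toSubmodule h.toSubalgebra)
    (((HopfAlgebra.antipode K (A := H)).restrictScalars R).comp h.toSubalgebra.val.toLinearMap)
    fun x => h.antipode_mem x x.2

lemma tensorInclusion_comulAlgHom (x : h.toSubalgebra) :
    tensorInclusion K h.toSubalgebra (h.comulAlgHom x) = Coalgebra.comul (R := K) (x : H) := by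
  have := (AlgEquiv.ofInjective _ (tensorInclusion_injective K h.toSubalgebra)).apply_symm_apply
    (((((Bialgebra.comulAlgHom K H).restrictScalars R).comp h.toSubalgebra.val).codRestrict
      (tensorInclusion K h.toSubalgebra).range fun x => h.comul_mem x x.2) x)
  exact congrArg Subtype.val this

lemma algebraMap_counitAlgHom (x : h.toSubalgebra) :
    algebraMap R K (h.counitAlgHom x) = Coalgebra.counit (R := K) (x : H) := by
  have := (AlgEquiv.ofInjective (Algebra.ofId R K)
    (IsFractionRing.injective R K)).apply_symm_apply
    (((((Bialgebra.counitAlgHom K H).restrictScalars R).comp h.toSubalgebra.val).codRestrict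
      (Algebra.ofId R K).range fun x => h.counit_mem x x.2) x)
  exact congrArg Subtype.val this

lemma tensorInclusion_tmul (B : Subalgebra R H) (a b : B) :
    tensorInclusion K B (a ⊗ₜ b) = (a : H) ⊗ₜ[K] (b : H) := rfl

variable (K) in
/-- The natural map `A ⊗[R] (A ⊗[R] A) → H ⊗[K] (H ⊗[K] H)`. -/
def tensorInclusion₃ (B : Subalgebra R H) :
    B ⊗[R] (B ⊗[R] B) →ₗ[R] H ⊗[K] (H ⊗[K] H) :=
  TensorProduct.mapOfCompatibleSMul K R R H (H ⊗[K] H) ∘ₗ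
    TensorProduct.map B.val.toLinearMap (tensorInclusion K B).toLinearMap

variable (K) in
lemma tensorInclusion₃_injective (B : Subalgebra R H) :
    Function.Injective (tensorInclusion₃ K B) := by
  have := compatibleSMul (R := R) (K := K) H (H ⊗[K] H)
  have : Module.Flat R H := flat (K := K) H
  have : Module.Flat R (H ⊗[K] H) := flat (K := K) (H ⊗[K] H)
  have : Module.Flat R B := flat_subalgebra B
  have h1 : Function.Injective
      (TensorProduct.map B.val.toLinearMap (tensorInclusion K B).toLinearMap) :=
    TensorProduct.map_injective_of_flat_flat _ _ Subtype.val_injective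
      (tensorInclusion_injective K B)
  exact (TensorProduct.equivOfCompatibleSMul R K R H (H ⊗[K] H)).symm.injective.comp h1

lemma tensorInclusion₃_tmul (B : Subalgebra R H) (a : B) (t : B ⊗[R] B) :
    tensorInclusion₃ K B (a ⊗ₜ t) = (a : H) ⊗ₜ[K] tensorInclusion K B t := rfl

lemma tensorInclusion₃_assoc (B : Subalgebra R H) (t : B ⊗[R] B) (b : B) :
    tensorInclusion₃ K B (TensorProduct.assoc R B B B (t ⊗ₜ b)) =
      TensorProduct.assoc K H H H (tensorInclusion K B t ⊗ₜ (b : H)) := by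
  induction t with
  | zero =>
    rw [TensorProduct.zero_tmul, LinearEquiv.map_zero, LinearMap.map_zero, map_zero,
      TensorProduct.zero_tmul, LinearEquiv.map_zero]
  | add x y hx hy =>
    rw [TensorProduct.add_tmul, LinearEquiv.map_add, LinearMap.map_add, hx, hy, map_add,
      TensorProduct.add_tmul, LinearEquiv.map_add]
  | tmul x y => rfl

lemma coassoc_aux (t : h.toSubalgebra ⊗[R] h.toSubalgebra) :
    tensorInclusion₃ K h.toSubalgebra (TensorProduct.assoc R _ _ _
      (TensorProduct.map h.comulAlgHom.toLinearMap LinearMap.id t)) =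
    TensorProduct.assoc K H H H ((Coalgebra.comul (R := K)).rTensor H
      (tensorInclusion K h.toSubalgebra t)) := by
  induction t with
  | zero =>
    rw [LinearMap.map_zero, LinearEquiv.map_zero, LinearMap.map_zero, map_zero,
      LinearMap.map_zero, LinearEquiv.map_zero]
  | add x y hx hy =>
    rw [LinearMap.map_add, LinearEquiv.map_add, LinearMap.map_add, hx, hy, map_add,
      LinearMap.map_add, LinearEquiv.map_add]
  | tmul x y =>
    rw [TensorProduct.map_tmul, LinearMap.id_apply, tensorInclusion₃_assoc,
      AlgHom.toLinearMap_apply, tensorInclusion_comulAlgHom]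
    rfl

lemma coassoc_aux' (t : h.toSubalgebra ⊗[R] h.toSubalgebra) :
    tensorInclusion₃ K h.toSubalgebra
      (TensorProduct.map LinearMap.id h.comulAlgHom.toLinearMap t) =
    (Coalgebra.comul (R := K)).lTensor H (tensorInclusion K h.toSubalgebra t) := by
  induction t with
  | zero => simp
  | add x y hx hy => simp only [map_add, hx, hy]
  | tmul x y =>
    rw [TensorProduct.map_tmul, LinearMap.id_apply, tensorInclusion₃_tmul,
      AlgHom.toLinearMap_apply, tensorInclusion_comulAlgHom]
    rfl

lemma counit_aux (t : h.toSubalgebra ⊗[R] h.toSubalgebra) :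
    ((TensorProduct.lid R _ (TensorProduct.map h.counitAlgHom.toLinearMap LinearMap.id t) :
      h.toSubalgebra) : H) =
    TensorProduct.lid K H ((Coalgebra.counit (R := K)).rTensor H
      (tensorInclusion K h.toSubalgebra t)) := by
  induction t with
  | zero => simp
  | add x y hx hy => simp only [map_add, hx, hy, Subalgebra.coe_add]
  | tmul x y =>
    rw [tensorInclusion_tmul, LinearMap.rTensor_tmul, ← algebraMap_counitAlgHom]
    simp [TensorProduct.lid_tmul]

lemma counit_aux' (t : h.toSubalgebra ⊗[R] h.toSubalgebra) :
    ((TensorProduct.rid R _ (TensorProduct.map LinearMap.id h.counitAlgHom.toLinearMap t) :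
      h.toSubalgebra) : H) =
    TensorProduct.rid K H ((Coalgebra.counit (R := K)).lTensor H
      (tensorInclusion K h.toSubalgebra t)) := by
  induction t with
  | zero => simp
  | add x y hx hy => simp only [map_add, hx, hy, Subalgebra.coe_add]
  | tmul x y =>
    rw [tensorInclusion_tmul, LinearMap.lTensor_tmul, ← algebraMap_counitAlgHom]
    simp [TensorProduct.rid_tmul]

lemma antipode_aux (t : h.toSubalgebra ⊗[R] h.toSubalgebra) :
    ((LinearMap.mul' R _ (h.antipodeLinearMap.rTensor _ t) : h.toSubalgebra) : H) =
    LinearMap.mul' K H ((HopfAlgebra.antipode K).rTensor H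
      (tensorInclusion K h.toSubalgebra t)) := by
  induction t with
  | zero => simp
  | add x y hx hy => simp only [map_add, hx, hy, Subalgebra.coe_add]
  | tmul x y => rfl

lemma antipode_aux' (t : h.toSubalgebra ⊗[R] h.toSubalgebra) :
    ((LinearMap.mul' R _ (h.antipodeLinearMap.lTensor _ t) : h.toSubalgebra) : H) =
    LinearMap.mul' K H ((HopfAlgebra.antipode K).lTensor H
      (tensorInclusion K h.toSubalgebra t)) := by
  induction t with
  | zero => simp
  | add x y hx hy => simp only [map_add, hx, hy, Subalgebra.coe_add]
  | tmul x y => rfl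

/-- A Hopf subalgebra `A` over `R` is itself a Hopf algebra over `R`, with the operations
restricted from `H`. -/
@[reducible] def hopfAlgebra : HopfAlgebra R h.toSubalgebra :=
  letI : Bialgebra R h.toSubalgebra := Bialgebra.ofAlgHom h.comulAlgHom h.counitAlgHom
    (by
      ext x
      apply tensorInclusion₃_injective K h.toSubalgebra
      refine (h.coassoc_aux (h.comulAlgHom x)).trans ?_
      refine Eq.trans ?_ (h.coassoc_aux' (h.comulAlgHom x)).symm
      rw [tensorInclusion_comulAlgHom]
      exact Coalgebra.coassoc_apply (R := K) (x : H))
    (by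
      ext x
      apply (TensorProduct.lid R h.toSubalgebra).injective
      apply Subtype.val_injective
      refine (h.counit_aux (h.comulAlgHom x)).trans ?_
      rw [tensorInclusion_comulAlgHom, Coalgebra.rTensor_counit_comul]
      simp)
    (by
      ext x
      apply (TensorProduct.rid R h.toSubalgebra).injective
      apply Subtype.val_injective
      refine (h.counit_aux' (h.comulAlgHom x)).trans ?_
      rw [tensorInclusion_comulAlgHom, Coalgebra.lTensor_counit_comul]
      simp)
  { antipode := h.antipodeLinearMap
    mul_antipode_rTensor_comul := by
      ext x
      refine (h.antipode_aux (h.comulAlgHom x)).trans ?_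
      rw [tensorInclusion_comulAlgHom, HopfAlgebra.mul_antipode_rTensor_comul_apply,
        ← algebraMap_counitAlgHom, ← IsScalarTower.algebraMap_apply]
      rfl
    mul_antipode_lTensor_comul := by
      ext x
      refine (h.antipode_aux' (h.comulAlgHom x)).trans ?_
      rw [tensorInclusion_comulAlgHom, HopfAlgebra.mul_antipode_lTensor_comul_apply,
        ← algebraMap_counitAlgHom, ← IsScalarTower.algebraMap_apply]
      rfl }

end IsHopfSubalgebra

end HopfSubalgebras

section QuantizedFunctionAlgebras

variable (k : Type u) [Field k]

instance : IsDedekindDomain k[T;T⁻¹] :=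
  IsLocalization.isDedekindDomain (Polynomial k)
    (powers_le_nonZeroDivisors_of_noZeroDivisors Polynomial.X_ne_zero) _

/-- Evaluation at `q = 1`, as a ring homomorphism `k[q, q⁻¹] → k`; the variable `q` is
`LaurentPolynomial.T 1`. -/
def evalOne : k[T;T⁻¹] →+* k := LaurentPolynomial.eval₂ (RingHom.id k) 1

/-- `k` as a `k[q, q⁻¹]`-algebra through `q ↦ 1`. -/
@[reducible] def evalOneAlgebra : Algebra k[T;T⁻¹] k := (evalOne k).toAlgebra

/-! Below, `Kq` is the field of rational functions `k(q)`, i.e. the fraction field of `k[q, q⁻¹]`. -/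

variable {k} (Kq : Type v) [Field Kq] [Algebra k[T;T⁻¹] Kq]
  {F : Type w} [Ring F] [HopfAlgebra Kq F] [Algebra k[T;T⁻¹] F] [IsScalarTower k[T;T⁻¹] Kq F]

open AlgebraicGeometry CategoryTheory in
/-- Mathlib's Hopf algebra structure on the algebra `Γ(G, ⊤)` of regular functions of an affine
group scheme `G` over `Spec R`. -/
@[reducible] def regularFunctionsHopfAlgebra (R : CommRingCat.{u}) (G : Scheme.{u})
    [G.Over (Spec R)] [GrpObj (G.asOver (Spec R))] [IsAffine G] : HopfAlgebra R Γ(G, ⊤) :=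
  inferInstance

open AlgebraicGeometry CategoryTheory in
/-- `(F, Fhat)` is a quantized function algebra: `Fhat` is an integer form of the Hopf algebra `F`
over `k[q, q⁻¹]`, and its specialization `k ⊗ Fhat` at `q = 1` is isomorphic, as a Hopf algebra
over `k`, to the algebra of regular functions of an (affine) algebraic group `G` over `k`, i.e. of
an affine group scheme of finite type over `k`. -/
def IsQFA [IsFractionRing k[T;T⁻¹] Kq] (Fhat : Submodule k[T;T⁻¹] F) : Prop :=
  ∃ h : IsIntegerForm Kq Fhat,
    letI := evalOneAlgebra k
    letI := h.hopfAlgebra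
    ∃ (G : Scheme.{u}) (_ : G.Over (Spec (.of k))) (_ : GrpObj (G.asOver (Spec (.of k))))
      (_ : IsAffine G), LocallyOfFiniteType (G ↘ Spec (.of k)) ∧
        letI : HopfAlgebra k Γ(G, ⊤) := regularFunctionsHopfAlgebra (.of k) G
        Nonempty (k ⊗[k[T;T⁻¹]] h.toSubalgebra ≃ₐc[k] Γ(G, ⊤))

/-- The kernel `I` of `ev₁ ∘ ε : Fhat → k[q, q⁻¹] → k`. -/
def augmentationIdeal (Fhat : Submodule k[T;T⁻¹] F) : Submodule k[T;T⁻¹] F where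
  carrier := {x | x ∈ Fhat ∧ ∃ r : k[T;T⁻¹],
    algebraMap k[T;T⁻¹] Kq r = Coalgebra.counit (R := Kq) x ∧ evalOne k r = 0}
  zero_mem' := ⟨Fhat.zero_mem, 0, by simp, by simp⟩
  add_mem' := by
    rintro x y ⟨hx, r, hr, hr0⟩ ⟨hy, s, hs, hs0⟩
    exact ⟨Fhat.add_mem hx hy, r + s, by simp [hr, hs], by simp [hr0, hs0]⟩
  smul_mem' := by
    rintro c x ⟨hx, r, hr, hr0⟩
    refine ⟨Fhat.smul_mem c hx, c * r, ?_, by simp [hr0]⟩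
    rw [← algebraMap_smul Kq c x, map_smul, map_mul, hr, smul_eq_mul]

open scoped Pointwise in
/-- `Ftilde = ∑ₙ (q - 1)⁻ⁿ Iⁿ`, a `k[q, q⁻¹]`-submodule of `F`; here `Iⁿ` is the `k[q, q⁻¹]`-span of
the products of `n` elements of `I` (so `I⁰ = k[q, q⁻¹]`). -/
def tildeForm (Fhat : Submodule k[T;T⁻¹] F) : Submodule k[T;T⁻¹] F :=
  ⨆ n : ℕ, ((algebraMap k[T;T⁻¹] Kq (LaurentPolynomial.T 1 - 1))⁻¹ ^ n) •
    augmentationIdeal Kq Fhat ^ n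

end QuantizedFunctionAlgebras

end QuantumDuality

end

/-!
Write `ε` for the counit, `R = k[q, q⁻¹]`, `d = q - 1`, `A = Fhat`, and `I ⊆ A` for the kernel
of `ev₁ ∘ ε`.
Since an element of `R` vanishing at `q = 1` is a multiple of `d`, an element `x` of `A` lies in `I`
exactly when `ε x ∈ d R`. As `d⁻ⁿ Iⁿ = (d⁻¹ I)ⁿ`, the submodule `∑ₙ d⁻ⁿ Iⁿ` is the
`R`-subalgebra `B` of `F` generated by `d⁻¹ I` (`iSup_pow_smul_pow_eq_adjoin`), and `A ⊆ B` because
`d A ⊆ I`. All the Hopf subalgebra conditions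
are therefore to be checked on the generators `d⁻¹ x`, `x ∈ I`.

* Counit: `ε (d⁻¹ x) = d⁻¹ ε x ∈ R`.
* Antipode: `S` is an antihomomorphism preserving `A` and `ε`, hence `S I ⊆ I`.
* Comultiplication: with `P x = x - ε x`, which maps `A` into `ker ε ∩ A ⊆ I`, one has
  `Δ x = (P ⊗ P) (Δ x) + x ⊗ 1 + 1 ⊗ x - ε x (1 ⊗ 1)`. Multiplying by `d⁻¹`, the first summand lies in
  the image of `d⁻¹ I ⊗ A`, and the others lie in the image of `B ⊗ B` because
  `d⁻¹ x` and `d⁻¹ ε x` lie in `B`.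

The base change condition passes from `A` to every submodule of `F` containing `A`, since
it says that `F` is a localization of the submodule, and `F` is torsion-free over `R`
(`isBaseChange_subtype_of_le`).
-/

open scoped Pointwise

namespace QuantumDuality

/-! ### Rescaled integer forms over a general base ring -/

variable {R : Type u} {K : Type v} {H : Type w} [CommRing R] [Field K] [Algebra R K]
  [Ring H] [HopfAlgebra K H] [Algebra R H] [IsScalarTower R K H]

lemma iSup_pow_smul_pow_eq_adjoin (c : K) (I : Submodule R H) :
    ⨆ n : ℕ, c ^ n • I ^ n =
      Subalgebra.toSubmodule (Algebra.adjoin R ((c • I : Submodule R H) : Set H)) := by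
  simp_rw [← smul_pow]
  refine le_antisymm (iSup_le fun n => ?_) ?_
  · induction n with
    | zero => exact Submodule.one_le.2 (one_mem (Algebra.adjoin R _))
    | succ n ih =>
      rw [pow_succ, Submodule.mul_le]
      exact fun x hx y hy => mul_mem (S := Subalgebra R H) (ih hx) (Algebra.subset_adjoin hy)
  · rw [Algebra.adjoin_eq_span, Submodule.span_le]
    intro x hx
    obtain ⟨n, hn⟩ : ∃ n, x ∈ (c • I) ^ n := by
      induction hx using Submonoid.closure_induction with
      | mem x hx => exact ⟨1, by rwa [pow_one]⟩
      | one => exact ⟨0, by rw [pow_zero]; exact Submodule.one_le.1 le_rfl⟩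
      | mul x y _ _ hx hy =>
        obtain ⟨m, hm⟩ := hx
        obtain ⟨n, hn⟩ := hy
        exact ⟨m + n, by rw [pow_add]; exact Submodule.mul_mem_mul hm hn⟩
    exact Submodule.mem_iSup_of_mem n hn

lemma isBaseChange_subtype_of_le [IsDomain R] [IsFractionRing R K] {A B : Submodule R H}
    (hAB : A ≤ B) (hA : IsBaseChange K A.subtype) : IsBaseChange K B.subtype := by
  rw [← isLocalizedModule_iff_isBaseChange (nonZeroDivisors R) K] at hA ⊢
  refine ⟨hA.map_units, fun y => ?_, fun h => ⟨1, by rw [Subtype.val_injective h]⟩⟩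
  obtain ⟨⟨x, s⟩, h⟩ := hA.surj y
  exact ⟨⟨⟨x, hAB x.2⟩, s⟩, h⟩

lemma tmul_mem_range_tensorInclusion {B : Subalgebra R H} {a b : H} (ha : a ∈ B) (hb : b ∈ B) :
    a ⊗ₜ[K] b ∈ (tensorInclusion K B).range :=
  ⟨(⟨a, ha⟩ : B) ⊗ₜ (⟨b, hb⟩ : B), rfl⟩

variable (K H) in
/-- The projection `x ↦ x - ε x` of a Hopf algebra onto the kernel of its counit. -/
def counitComplement : H →ₗ[K] H :=
  LinearMap.id - Algebra.linearMap K H ∘ₗ Coalgebra.counit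

lemma counitComplement_apply (x : H) :
    counitComplement K H x = x - algebraMap K H (Coalgebra.counit x) := rfl

lemma counit_counitComplement (x : H) :
    Coalgebra.counit (R := K) (counitComplement K H x) = 0 := by
  rw [counitComplement_apply, map_sub, Bialgebra.counit_algebraMap, sub_self]

lemma map_counitComplement_comul (x : H) :
    TensorProduct.map (counitComplement K H) (counitComplement K H) (Coalgebra.comul (R := K) x) =
      Coalgebra.comul (R := K) x - x ⊗ₜ[K] 1 - 1 ⊗ₜ[K] x +
        algebraMap K H (Coalgebra.counit x) ⊗ₜ[K] 1 := by
  set e : H →ₗ[K] H := Algebra.linearMap K H ∘ₗ Coalgebra.counit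
  have hmap (t : H ⊗[K] H) : TensorProduct.map (counitComplement K H) (counitComplement K H) t =
      t - e.lTensor H t - e.rTensor H t + e.rTensor H (e.lTensor H t) := by
    induction t with
    | zero => simp
    | add s t hs ht =>
      simp only [map_add, hs, ht]
      abel
    | tmul a b =>
      change (a - e a) ⊗ₜ[K] (b - e b) = _
      simp only [LinearMap.lTensor_tmul, LinearMap.rTensor_tmul, TensorProduct.sub_tmul,
        TensorProduct.tmul_sub]
      abel
  have hl : e.lTensor H (Coalgebra.comul (R := K) x) = x ⊗ₜ[K] 1 := by
    rw [LinearMap.lTensor_comp_apply, Coalgebra.lTensor_counit_comul]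
    simp
  have hr : e.rTensor H (Coalgebra.comul (R := K) x) = 1 ⊗ₜ[K] x := by
    rw [LinearMap.rTensor_comp_apply, Coalgebra.rTensor_counit_comul]
    simp
  rw [hmap, hl, hr, LinearMap.rTensor_tmul]
  rfl

/-- The submodule `I` stands for `{x ∈ A | ε x ∈ d R}`, the preimage in `A` of the
ideal `d R` under the counit. -/
lemma IsIntegerForm.iSup_pow_smul_pow [IsDomain R] [IsFractionRing R K] {A I : Submodule R H}
    (hA : IsIntegerForm K A) {d : R} (hd : d ≠ 0)
    (hI : ∀ x, x ∈ I ↔ x ∈ A ∧ ∃ s, algebraMap R K (d * s) = Coalgebra.counit (R := K) x) :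
    IsIntegerForm K (⨆ n : ℕ, (algebraMap R K d)⁻¹ ^ n • I ^ n) := by
  have hd' : algebraMap R K d ≠ 0 := by simpa using hd
  rw [iSup_pow_smul_pow_eq_adjoin]
  set c := (algebraMap R K d)⁻¹
  set B := Algebra.adjoin R ((c • I : Submodule R H) : Set H)
  have hIB : ∀ x ∈ I, c • x ∈ B := fun x hx =>
    Algebra.subset_adjoin (Submodule.smul_mem_pointwise_smul x c I hx)
  have hAB : ∀ x ∈ A, x ∈ B := by
    intro x hx
    obtain ⟨r, hr⟩ := hA.counit_mem x hx
    have hdx : d • x ∈ I := (hI _).2 ⟨A.smul_mem d hx, r, by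
      rw [map_mul, hr, ← algebraMap_smul K d x, map_smul, smul_eq_mul]⟩
    have hcd := hIB _ hdx
    rwa [← algebraMap_smul K d x, smul_smul, inv_mul_cancel₀ hd', one_smul] at hcd
  have hP : ∀ x ∈ A, counitComplement K H x ∈ I := by
    intro x hx
    refine (hI _).2 ⟨?_, 0, by rw [counit_counitComplement, mul_zero, map_zero]⟩
    obtain ⟨r, hr⟩ := hA.counit_mem x hx
    rw [counitComplement_apply, ← hr, ← IsScalarTower.algebraMap_apply,
      Algebra.algebraMap_eq_smul_one]
    exact A.sub_mem hx (A.smul_mem r hA.one_mem)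
  -- One factor `c` suffices: the second tensor factor is left in `I ⊆ A ⊆ B`.
  have hPP : ∀ t ∈ (tensorInclusion K hA.toSubalgebra).range,
      c • TensorProduct.map (counitComplement K H) (counitComplement K H) t ∈
        (tensorInclusion K B).range := by
    rintro _ ⟨t, rfl⟩
    induction t with
    | zero =>
      rw [map_zero, map_zero, smul_zero]
      exact zero_mem _
    | add x y hx hy =>
      rw [map_add, map_add, smul_add]
      exact add_mem hx hy
    | tmul a b =>
      change c • (counitComplement K H a ⊗ₜ[K] counitComplement K H b) ∈ _
      rw [TensorProduct.smul_tmul']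
      exact tmul_mem_range_tensorInclusion (hIB _ (hP _ a.2)) (hAB _ ((hI _).1 (hP _ b.2)).1)
  have hcomul : B ≤ (tensorInclusion K B).range.comap
      ((Bialgebra.comulAlgHom K H).restrictScalars R) := by
    refine Algebra.adjoin_le ?_
    rintro _ ⟨x, hx, rfl⟩
    rw [DistribSMul.toLinearMap_apply]
    change Coalgebra.comul (R := K) (c • x) ∈ (tensorInclusion K B).range
    obtain ⟨hxA, s, hs⟩ := (hI x).1 hx
    have hεx : c • algebraMap K H (Coalgebra.counit x) ∈ B := by
      have : c • algebraMap K H (Coalgebra.counit x) = algebraMap R H s := by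
        rw [← hs, map_mul, Algebra.smul_def, ← map_mul, inv_mul_cancel_left₀ hd',
          ← IsScalarTower.algebraMap_apply]
      rw [this]
      exact B.algebraMap_mem s
    have key : Coalgebra.comul (R := K) (c • x) =
        c • TensorProduct.map (counitComplement K H) (counitComplement K H)
            (Coalgebra.comul (R := K) x) +
          (c • x) ⊗ₜ[K] 1 + 1 ⊗ₜ[K] (c • x) -
            (c • algebraMap K H (Coalgebra.counit x)) ⊗ₜ[K] 1 := by
      rw [map_counitComplement_comul, map_smul, TensorProduct.tmul_smul,
        ← TensorProduct.smul_tmul', ← TensorProduct.smul_tmul', smul_add, smul_sub, smul_sub]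
      abel
    rw [key]
    exact sub_mem (add_mem (add_mem (hPP _ (hA.comul_mem x hxA))
      (tmul_mem_range_tensorInclusion (hIB x hx) B.one_mem))
      (tmul_mem_range_tensorInclusion B.one_mem (hIB x hx)))
      (tmul_mem_range_tensorInclusion hεx B.one_mem)
  have hcounit : B ≤ (Algebra.ofId R K).range.comap
      ((Bialgebra.counitAlgHom K H).restrictScalars R) := by
    refine Algebra.adjoin_le ?_
    rintro _ ⟨x, hx, rfl⟩
    obtain ⟨-, s, hs⟩ := (hI x).1 hx
    refine ⟨s, ?_⟩
    change algebraMap R K s = Coalgebra.counit (R := K) (c • x)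
    rw [map_smul, ← hs, map_mul, smul_eq_mul, inv_mul_cancel_left₀ hd']
  have hantipode : ∀ x ∈ B, HopfAlgebra.antipode K x ∈ B := by
    intro x hx
    induction hx using Algebra.adjoin_induction with
    | mem x hx =>
      obtain ⟨x, hx, rfl⟩ := hx
      change HopfAlgebra.antipode K (c • x) ∈ B
      rw [map_smul]
      obtain ⟨hxA, s, hs⟩ := (hI x).1 hx
      exact hIB _ ((hI _).2
        ⟨hA.antipode_mem x hxA, s, by rw [HopfAlgebra.counit_antipode, hs]⟩)
    | algebraMap r =>
      rw [IsScalarTower.algebraMap_apply R K H, Algebra.algebraMap_eq_smul_one, map_smul,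
        HopfAlgebra.antipode_one, ← Algebra.algebraMap_eq_smul_one,
        ← IsScalarTower.algebraMap_apply R K H]
      exact B.algebraMap_mem r
    | add x y _ _ hx hy =>
      rw [map_add]
      exact add_mem hx hy
    | mul x y _ _ hx hy =>
      rw [HopfAlgebra.antipode_mul_antidistrib]
      exact mul_mem hy hx
  exact
    { one_mem := B.one_mem
      mul_mem := fun _ _ => B.mul_mem
      comul_mem := fun x hx => hcomul hx
      counit_mem := fun x hx => hcounit hx
      antipode_mem := hantipode
      isBaseChange := isBaseChange_subtype_of_le hAB hA.isBaseChange }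

/-! ### Specialization at `q = 1` -/

lemma evalOne_eq_zero_iff_dvd {k : Type u} [Field k] {r : k[T;T⁻¹]} :
    evalOne k r = 0 ↔ LaurentPolynomial.T 1 - 1 ∣ r := by
  have hT : evalOne k (LaurentPolynomial.T 1) = 1 := by
    simp [evalOne]
  constructor
  · intro hr
    obtain ⟨n, p, hp⟩ := r.exists_T_pow
    have h1 : p.eval 1 = 0 := by
      have := congrArg (evalOne k) hp
      rw [map_mul, hr, zero_mul, evalOne, LaurentPolynomial.eval₂_toLaurent] at this
      simpa [Polynomial.eval₂_id] using this
    obtain ⟨s, rfl⟩ := Polynomial.dvd_iff_isRoot.2 h1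
    refine ((LaurentPolynomial.isUnit_T (n : ℤ)).dvd_mul_right).1 ⟨Polynomial.toLaurent s, ?_⟩
    rw [← hp]
    simp
  · rintro ⟨s, rfl⟩
    rw [map_mul, map_sub, hT, map_one, sub_self, zero_mul]

lemma T_one_sub_one_ne_zero {k : Type u} [Field k] :
    (LaurentPolynomial.T 1 - 1 : k[T;T⁻¹]) ≠ 0 := by
  have h := Polynomial.toLaurent_ne_zero.2 (Polynomial.X_sub_C_ne_zero (1 : k))
  simpa using h

end QuantumDuality

theorem proposition2p5 {k : Type u} [Field k] [CharZero k]
    {Kq : Type v} [Field Kq] [Algebra k[T;T⁻¹] Kq] [IsFractionRing k[T;T⁻¹] Kq]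
    {F : Type w} [Ring F] [HopfAlgebra Kq F] [Algebra k[T;T⁻¹] F] [IsScalarTower k[T;T⁻¹] Kq F]
    (Fhat : Submodule k[T;T⁻¹] F) (hF : QuantumDuality.IsQFA Kq Fhat) :
    QuantumDuality.IsIntegerForm Kq (QuantumDuality.tildeForm Kq Fhat) := by
  obtain ⟨hA, -⟩ := hF
  refine hA.iSup_pow_smul_pow QuantumDuality.T_one_sub_one_ne_zero fun x => ?_
  refine and_congr_right fun _ => ⟨?_, ?_⟩
  · rintro ⟨r, hr, hr0⟩
    obtain ⟨s, rfl⟩ := QuantumDuality.evalOne_eq_zero_iff_dvd.1 hr0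
    exact ⟨s, hr⟩
  · rintro ⟨s, hs⟩
    exact ⟨_, hs, QuantumDuality.evalOne_eq_zero_iff_dvd.2 (dvd_mul_right _ s)⟩
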